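/- Conventions. Nets are indexed by nonempty directed sets. In a vector lattice $X$ (real, as are all spaces below), a net $(x_\alpha)_{\alpha\in A}$ converges in order to $x$ if there is a net $(y_\beta)_{\beta\in B}$, possibly over a different index set, such that $y_\beta\downarrow 0$ and for every $\beta\in B$ there is $\alpha_\beta\in A$ with $|x_\alpha-x|\le y_\beta$ for all $\alpha\ge\alpha_\beta$. The net uo-converges to $x$ if $|x_\alpha-x|\wedge y$ converges in order to $0$ for every $y\in X_+$. It is uo-Cauchy if the net $(x_\alpha-x_{\alpha'})_{(\alpha,\alpha')\in A\times A}$, with the product order on $A\times A$, uo-converges to $0$. The order continuous dual $X_n^\sim$ is the set of all order bounded linear functionals $f:X\to\mathbb R$ such that $f(x_\alpha)\to 0$ whenever $(x_\alpha)$ is a net in $X$ that converges in order to $0$. A Banach lattice $X$ has the weak Fatou property if there is a real $r>0$ such that every increasing net $(x_\alpha)$ in $X$ with a supremum $x\in X$ satisfies $\|x\|\le r\sup_\alpha\|x_\alpha\|$ (with value $+\infty$ allowed on the right). Theorem 3.7 (norm bounded increasing nets are uo-Cauchy). Let $X$ be a Banach lattice that satisfies at least one of the following conditions: (i) $X_n^\sim$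 separates the points of $X$; (ii) $X$ has the weak Fatou property. Let $(x_\alpha)$ be an increasing net of positive elements of $X$ with $\sup_\alpha\|x_\alpha\|<\infty$. Then $(x_\alpha)$ is uo-Cauchy in $X$. -/

import Mathlib

/-!
Order convergence, unbounded order convergence, the order continuous dual and the weak Fatou
property. A net is a family indexed by a nonempty directed preorder.
-/

universe u v

/-- Order convergence of a net `x` to `l` in a vector lattice: there is a net `y` decreasing
to `0`, possibly over another index set, such that for every `b` a tail of `|x - l|` lies
below `y b`. Since `y` may be replaced by its range, index sets in the universe of `X` suffice. -/
def OrderConverges {X : Type u} [Lattice X] [AddCommGroup X] {ι : Type v} [Preorder ι]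
    (x : ι → X) (l : X) : Prop :=
  ∃ (B : Type u) (_ : Preorder B) (_ : IsDirectedOrder B) (_ : Nonempty B) (y : B → X),
    Antitone y ∧ IsGLB (Set.range y) 0 ∧ ∀ b : B, ∃ a₀ : ι, ∀ a : ι, a₀ ≤ a → |x a - l| ≤ y b

/-- Unbounded order convergence: `|x - l| ⊓ y` converges in order to `0` for every `y ≥ 0`. -/
def UOConverges {X : Type u} [Lattice X] [AddCommGroup X] {ι : Type v} [Preorder ι]
    (x : ι → X) (l : X) : Prop :=
  ∀ y : X, 0 ≤ y → OrderConverges (fun a => |x a - l| ⊓ y) 0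

/-- A net `x` is uo-Cauchy if the double net `(x a - x b)`, indexed by the pairs `(a, b)` with
the product order, converges in unbounded order to `0`. -/
def UOCauchy {X : Type u} [Lattice X] [AddCommGroup X] {ι : Type v} [Preorder ι]
    (x : ι → X) : Prop :=
  UOConverges (fun p : ι × ι => x p.1 - x p.2) 0

/-- The order continuous dual: the order bounded linear functionals `f` such that `f ∘ x`
converges to `0` for every net `x` that converges in order to `0`. (For nets of real numbers
order convergence is the usual convergence. Index sets in the universe of `X` suffice, because
a net dominated by `y` can be compared with the net of all `(b, z)` with `|z| ≤ y b`.) -/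
def orderContinuousDual (X : Type u) [Lattice X] [AddCommGroup X] [Module ℝ X] :
    Set (X →ₗ[ℝ] ℝ) :=
  {f | (∀ a b : X, ∃ M : ℝ, ∀ z ∈ Set.Icc a b, |f z| ≤ M) ∧
    ∀ (ι : Type u) [Preorder ι] [IsDirectedOrder ι] [Nonempty ι] (x : ι → X),
      OrderConverges x 0 → Filter.Tendsto (fun a => f (x a)) Filter.atTop (nhds 0)}

/-- The order continuous dual of `X` separates the points of `X`. -/
def OrderContinuousDualSeparatesPoints (X : Type u) [Lattice X] [AddCommGroup X]
    [Module ℝ X] : Prop :=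
  ∀ x y : X, x ≠ y → ∃ f ∈ orderContinuousDual X, f x ≠ f y

/-- The weak Fatou property: there is `r > 0` such that every increasing net `x` with a
supremum `s` in `X` satisfies `‖s‖ ≤ r * sup ‖x a‖`; nothing is required when the norms are
unbounded, where the right-hand side is infinite. Only the range of `x` matters, so index sets
in the universe of `X` suffice. -/
def WeakFatouProperty (X : Type u) [Lattice X] [NormedAddCommGroup X] : Prop :=
  ∃ r : ℝ, 0 < r ∧ ∀ (ι : Type u) [Preorder ι] [IsDirectedOrder ι] [Nonempty ι] (x : ι → X)
    (s : X), Monotone x → IsLUB (Set.range x) s → BddAbove (Set.range fun a => ‖x a‖) →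
      ‖s‖ ≤ r * ⨆ a, ‖x a‖

open Set Filter

/-! Fix `y ≥ 0` and let `z ≥ 0` lie below every tail bound of `|x a - x b| ⊓ y`; the claim is `z =
0`. No tail of the net stops growing in the direction of `z`: for each `a₀`, `z` is the supremum of
`(x a - x a₀) ⊓ z` (`le_of_forall_increment_inf_le`). Adding up such increments shows that `n • z`
is the supremum of the increasing net `x a ⊓ n • z` (`isLUB_range_inf_nsmul`), whose norms are
bounded independently of `n`. Either hypothesis carries this bound over to the supremum, so `n *
‖z‖`, or `n * |f z|` for a separating `f`, stays bounded and `z = 0`. No order completion is needed.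
-/

/-- A lattice-ordered group with a solid norm over the reals is Archimedean. -/
theorem eq_zero_of_forall_nsmul_le {X : Type u} [Lattice X] [NormedAddCommGroup X]
    [IsOrderedAddMonoid X] [NormedSpace ℝ X] [HasSolidNorm X] {d e : X} (hd : 0 ≤ d)
    (h : ∀ n : ℕ, n • d ≤ e) : d = 0 := by
  by_contra hne
  have hpos : 0 < ‖d‖ := norm_pos_iff.2 hne
  obtain ⟨n, hn⟩ := exists_nat_gt (‖e‖ / ‖d‖)
  have h1 : ‖n • d‖ ≤ ‖e‖ :=
    norm_le_norm_of_abs_le_abs (abs_le_abs_of_nonneg (nsmul_nonneg hd n) (h n))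
  rw [← Nat.cast_smul_eq_nsmul ℝ, norm_smul, Real.norm_natCast] at h1
  rw [div_lt_iff₀ hpos] at hn
  linarith

theorem inf_sub_inf_le_sub {X : Type u} [Lattice X] [AddCommGroup X] [IsOrderedAddMonoid X]
    {v y z : X} (h : z ≤ y) : v ⊓ y - v ⊓ z ≤ y - z := by
  have : v ⊓ y ≤ (y - z) + v ⊓ z := by
    rw [add_inf]
    exact le_inf (inf_le_left.trans (le_add_of_nonneg_left (sub_nonneg.2 h)))
      (by simp)
  exact sub_le_iff_le_add.2 this

theorem inf_add_inf_le_inf_add {X : Type u} [Lattice X] [AddCommGroup X] [IsOrderedAddMonoid X]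
    (a b c d : X) : a ⊓ b + c ⊓ d ≤ (a + c) ⊓ (b + d) :=
  le_inf (add_le_add inf_le_left inf_le_left) (add_le_add inf_le_right inf_le_right)

/-- The elements that dominate `|x a - x b| ⊓ y` for all `a, b` in some tail of the net. -/
def cauchyTailBounds {X : Type u} [Lattice X] [AddCommGroup X] {ι : Type v} [Preorder ι]
    (x : ι → X) (y : X) : Set X :=
  {d | ∃ a₀, ∀ a b, a₀ ≤ a → a₀ ≤ b → |x a - x b| ⊓ y ≤ d}

theorem mem_cauchyTailBounds_of_monotone {X : Type u} [Lattice X] [AddCommGroup X]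
    [IsOrderedAddMonoid X] {ι : Type v} [Preorder ι] [IsDirectedOrder ι] {x : ι → X} {y d : X}
    (hx : Monotone x) (a₀ : ι) (h : ∀ a, a₀ ≤ a → (x a - x a₀) ⊓ y ≤ d) :
    d ∈ cauchyTailBounds x y := by
  refine ⟨a₀, fun a b ha hb => ?_⟩
  obtain ⟨c, hac, hbc⟩ := exists_ge_ge a b
  refine le_trans (inf_le_inf_right y ?_) (h c (ha.trans hac))
  rw [abs_le', neg_sub]
  exact ⟨sub_le_sub (hx hac) (hx hb), sub_le_sub (hx hbc) (hx ha)⟩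

/-- The tail bounds, in reversed order, serve as their own dominating net: they contain `y` and are
closed under meets. -/
theorem uoCauchy_of_isGLB_cauchyTailBounds {X : Type u} [Lattice X] [AddCommGroup X]
    [IsOrderedAddMonoid X] {ι : Type v} [Preorder ι] [IsDirectedOrder ι] [Nonempty ι] {x : ι → X}
    (h : ∀ y : X, 0 ≤ y → IsGLB (cauchyTailBounds x y) 0) : UOCauchy x := by
  intro y hy
  let B := (cauchyTailBounds x y)ᵒᵈ
  have hdir : IsDirectedOrder B := by
    refine ⟨?_⟩
    rintro ⟨d, a, hd⟩ ⟨e, b, he⟩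
    obtain ⟨c, hac, hbc⟩ := exists_ge_ge a b
    exact ⟨OrderDual.toDual ⟨d ⊓ e, c, fun i j hi hj => le_inf
      (hd i j (hac.trans hi) (hac.trans hj)) (he i j (hbc.trans hi) (hbc.trans hj))⟩,
      show d ⊓ e ≤ d from inf_le_left, show d ⊓ e ≤ e from inf_le_right⟩
  refine ⟨B, inferInstance, hdir, ?_, fun b => (OrderDual.ofDual b : cauchyTailBounds x y),
    fun p q hpq => hpq, ?_, ?_⟩
  · exact ⟨OrderDual.toDual ⟨y, Classical.arbitrary ι, fun _ _ _ _ => inf_le_right⟩⟩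
  · have : range (fun b : B => ((OrderDual.ofDual b : cauchyTailBounds x y) : X)) =
        cauchyTailBounds x y := Subtype.range_coe
    rw [this]
    exact h y hy
  · rintro ⟨d, a₀, hd⟩
    refine ⟨(a₀, a₀), fun a ha => ?_⟩
    simp only [sub_zero]
    rw [abs_of_nonneg (le_inf (abs_nonneg _) hy)]
    exact hd _ _ ha.1 ha.2

/-- A positive lower bound of the tail bounds is the supremum of its meets with the increments. -/
theorem le_of_forall_increment_inf_le {X : Type u} [Lattice X] [NormedAddCommGroup X]
    [IsOrderedAddMonoid X] [NormedSpace ℝ X] [HasSolidNorm X] {ι : Type v} [Preorder ι]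
    [IsDirectedOrder ι] {x : ι → X} (hx : Monotone x) {y z : X} (hz0 : 0 ≤ z)
    (hz : z ∈ lowerBounds (cauchyTailBounds x y)) (a₀ : ι) {d : X}
    (hd : ∀ a, a₀ ≤ a → (x a - x a₀) ⊓ z ≤ d) : z ≤ d := by
  -- Each bound obtained is a tail bound, hence lies above `z`. Cutting `(x a - x a₀) ⊓ y` at `z`
  -- then costs at most the bound minus `z`, and the part that remains is at most `d ⊓ z`; so the
  -- bound can be lowered by `z - d ⊓ z` again and again. As it stays nonnegative, the Archimedean
  -- property forces `z - d ⊓ z = 0`.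
  have key : ∀ n : ℕ, ∀ a, a₀ ≤ a → (x a - x a₀) ⊓ y ≤ y - n • (z - d ⊓ z) := by
    intro n
    induction n with
    | zero => simp
    | succ n ih =>
      intro a ha
      have hle : z ≤ y - n • (z - d ⊓ z) := hz (mem_cauchyTailBounds_of_monotone hx a₀ ih)
      have h1 := inf_sub_inf_le_sub (v := (x a - x a₀) ⊓ y) hle
      rw [inf_eq_left.2 (ih a ha), sub_le_iff_le_add] at h1
      have h2 : (x a - x a₀) ⊓ y ⊓ z ≤ d ⊓ z :=
        le_inf ((inf_le_inf_right z inf_le_left).trans (hd a ha)) inf_le_right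
      refine (h1.trans (add_le_add_right h2 _)).trans_eq ?_
      rw [succ_nsmul]
      abel
  have hd' : z - d ⊓ z = 0 := by
    refine eq_zero_of_forall_nsmul_le (e := y) (sub_nonneg.2 inf_le_right) fun n => ?_
    exact sub_nonneg.1 (hz0.trans (hz (mem_cauchyTailBounds_of_monotone hx a₀ (key n))))
  exact inf_eq_right.1 (sub_eq_zero.1 hd').symm

theorem isLUB_range_inf_nsmul {X : Type u} [Lattice X] [AddCommGroup X]
    [IsOrderedAddMonoid X] {ι : Type v} [Preorder ι] [Nonempty ι]
    {x : ι → X} (hpos : ∀ a, 0 ≤ x a) {z : X}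
    (hz : ∀ a₀ d, (∀ a, a₀ ≤ a → (x a - x a₀) ⊓ z ≤ d) → z ≤ d) (n : ℕ) :
    IsLUB (range fun a => x a ⊓ n • z) (n • z) := by
  induction n with
  | zero => simp [hpos]
  | succ n ih =>
    refine ⟨forall_mem_range.2 fun a => inf_le_right, fun w hw => ?_⟩
    rw [mem_upperBounds, forall_mem_range] at hw
    -- With `a₀` fixed, `(x a - x a₀) ⊓ z + x a₀ ⊓ n • z ≤ x a ⊓ (n + 1) • z ≤ w`; take the supremum
    -- over `a`, then over `a₀`.
    rw [succ_nsmul, ← le_sub_iff_add_le]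
    refine ih.2 (forall_mem_range.2 fun a₀ => ?_)
    rw [le_sub_comm]
    refine hz a₀ _ fun a _ => ?_
    rw [le_sub_iff_add_le']
    refine (inf_add_inf_le_inf_add _ _ _ _).trans ?_
    rw [add_sub_cancel, ← succ_nsmul]
    exact hw a

/-- An order bounded functional on a Banach lattice is norm bounded on the positive cone. -/
theorem exists_abs_le_mul_norm_of_orderBounded {X : Type u} [Lattice X] [NormedAddCommGroup X]
    [IsOrderedAddMonoid X] [NormedSpace ℝ X] [IsOrderedModule ℝ X] [HasSolidNorm X]
    [CompleteSpace X] (f : X →ₗ[ℝ] ℝ) (hf : ∀ a b : X, ∃ M : ℝ, ∀ z ∈ Icc a b, |f z| ≤ M) :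
    ∃ C : ℝ, ∀ w : X, 0 ≤ w → |f w| ≤ C * ‖w‖ := by
  by_contra! hcon
  -- The growth `4 ^ n` leaves room to rescale to norm `2 ^ (-n)`, which is summable, while `|f|`
  -- still exceeds `2 ^ n`; all the rescaled vectors lie in the order interval from `0` to their
  -- sum.
  choose w hw0 hw using fun n : ℕ => hcon (4 ^ n)
  have hwpos : ∀ n, 0 < ‖w n‖ := fun n => by
    refine norm_pos_iff.2 fun h0 => ?_
    have := hw n
    simp [h0] at this
  let v : ℕ → X := fun n => ((2 ^ n * ‖w n‖)⁻¹ : ℝ) • w n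
  have hv0 : ∀ n, 0 ≤ v n := fun n => smul_nonneg (by positivity) (hw0 n)
  have hvnorm : ∀ n, ‖v n‖ = (1 / 2) ^ n := fun n => by
    have := (hwpos n).ne'
    rw [norm_smul, Real.norm_of_nonneg (by positivity), one_div, inv_pow]
    field_simp
  have hfv : ∀ n, (2 : ℝ) ^ n < |f (v n)| := fun n => by
    have hp : (0 : ℝ) < 2 ^ n * ‖w n‖ := mul_pos (by positivity) (hwpos n)
    rw [map_smul, smul_eq_mul, abs_mul, abs_of_pos (inv_pos.2 hp), ← div_eq_inv_mul,
      lt_div_iff₀ hp, ← mul_assoc, ← mul_pow]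
    norm_num
    exact hw n
  have hsum : Summable v := Summable.of_norm (by
    simp_rw [hvnorm]
    exact summable_geometric_two)
  obtain ⟨M, hM⟩ := hf 0 (∑' n, v n)
  obtain ⟨n, hn⟩ := pow_unbounded_of_one_lt M (one_lt_two (α := ℝ))
  exact absurd ((hn.trans (hfv n)).trans_le
    (hM (v n) ⟨hv0 n, hsum.le_tsum n fun j _ => hv0 j⟩)) (lt_irrefl _)

theorem isDirectedOrder_range {X : Type u} [Preorder X] {ι : Type v} [Preorder ι]
    [IsDirectedOrder ι] {g : ι → X} (hg : Monotone g) : IsDirectedOrder (range g) := by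
  refine ⟨?_⟩
  rintro ⟨_, a, rfl⟩ ⟨_, b, rfl⟩
  obtain ⟨c, hac, hbc⟩ := exists_ge_ge a b
  exact ⟨⟨g c, c, rfl⟩, hg hac, hg hbc⟩

/-- Passing to the range of `g` replaces an index set in an arbitrary universe by one in the
universe of `X`. -/
theorem WeakFatouProperty.exists_norm_le {X : Type u} [Lattice X] [NormedAddCommGroup X]
    (hX : WeakFatouProperty X) {ι : Type v} [Preorder ι] [IsDirectedOrder ι] [Nonempty ι] :
    ∃ r : ℝ, 0 < r ∧ ∀ (g : ι → X) (s : X) (M : ℝ), Monotone g → IsLUB (range g) s →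
      (∀ a, ‖g a‖ ≤ M) → ‖s‖ ≤ r * M := by
  obtain ⟨r, hr, h⟩ := hX
  refine ⟨r, hr, fun g s M hg hs hM => ?_⟩
  have := isDirectedOrder_range hg
  have hM' : ∀ p : range g, ‖(p : X)‖ ≤ M := by
    rintro ⟨_, a, rfl⟩
    exact hM a
  refine (h (range g) (fun p => (p : X)) s (fun _ _ hpq => hpq) (by rwa [Subtype.range_coe])
    ⟨M, forall_mem_range.2 hM'⟩).trans ?_
  exact mul_le_mul_of_nonneg_left (ciSup_le hM') hr.le

/-- The net `s - p`, with `p` in the range of `g`, decreases to `0`, so `f p` tends to `f s` and the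
bound survives in the limit. -/
theorem abs_apply_le_of_isLUB {X : Type u} [Lattice X] [AddCommGroup X] [IsOrderedAddMonoid X]
    [Module ℝ X] {f : X →ₗ[ℝ] ℝ} (hf : f ∈ orderContinuousDual X) {ι : Type v} [Preorder ι]
    [IsDirectedOrder ι] [Nonempty ι] {g : ι → X} {s : X} {M : ℝ} (hg : Monotone g)
    (hs : IsLUB (range g) s) (hM : ∀ a, |f (g a)| ≤ M) : |f s| ≤ M := by
  have := isDirectedOrder_range hg
  have hconv : OrderConverges (fun p : range g => s - p) 0 := by
    refine ⟨range g, inferInstance, this, inferInstance, fun p => s - p,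
      fun p q hpq => sub_le_sub_left (show (p : X) ≤ q from hpq) s, ⟨?_, fun w hw => ?_⟩, fun b => ⟨b, fun a hab => ?_⟩⟩
    · exact forall_mem_range.2 fun p => sub_nonneg.2 (hs.1 p.2)
    · rw [mem_lowerBounds, forall_mem_range] at hw
      have : s ≤ s - w := hs.2 fun p hp => le_sub_comm.1 (hw ⟨p, hp⟩)
      simpa using this
    · rw [sub_zero, abs_of_nonneg (sub_nonneg.2 (hs.1 a.2))]
      exact sub_le_sub_left (show (b : X) ≤ a from hab) s
  have hlim := ((hf.2 (range g) _ hconv).const_sub (f s)).abs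
  simp only [map_sub, sub_sub_cancel, sub_zero] at hlim
  refine le_of_tendsto hlim (Eventually.of_forall ?_)
  rintro ⟨_, a, rfl⟩
  exact hM a

theorem theorem3p7 {X : Type u} [Lattice X] [NormedAddCommGroup X] [IsOrderedAddMonoid X]
    [NormedSpace ℝ X] [IsOrderedModule ℝ X] [HasSolidNorm X] [CompleteSpace X]
    (hX : OrderContinuousDualSeparatesPoints X ∨ WeakFatouProperty X)
    {ι : Type v} [Preorder ι] [IsDirectedOrder ι] [Nonempty ι] (x : ι → X)
    (hpos : ∀ a, 0 ≤ x a) (hmono : Monotone x) (hbdd : ∃ M : ℝ, ∀ a, ‖x a‖ ≤ M) :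
    UOCauchy x := by
  refine uoCauchy_of_isGLB_cauchyTailBounds fun y hy => ⟨?_, fun w hw => ?_⟩
  · rintro d ⟨a, hd⟩
    exact (le_inf (abs_nonneg _) hy).trans (hd a a le_rfl le_rfl)
  -- Tail bounds are nonnegative, so a lower bound may be replaced by its positive part.
  have hz : w ⊔ 0 ∈ lowerBounds (cauchyTailBounds x y) := by
    rintro d ⟨a, hd⟩
    exact sup_le (hw ⟨a, hd⟩) ((le_inf (abs_nonneg _) hy).trans (hd a a le_rfl le_rfl))
  set z := w ⊔ 0
  have hz0 : 0 ≤ z := le_sup_right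
  obtain ⟨M, hM⟩ := hbdd
  have hlub := isLUB_range_inf_nsmul hpos (z := z)
    fun a₀ d hd => le_of_forall_increment_inf_le hmono hz0 hz a₀ hd
  have hginc : ∀ n : ℕ, Monotone fun a => x a ⊓ n • z :=
    fun n a b hab => inf_le_inf_right _ (hmono hab)
  have hg0 : ∀ (n : ℕ) a, 0 ≤ x a ⊓ n • z := fun n a => le_inf (hpos a) (nsmul_nonneg hz0 n)
  have hgM : ∀ (n : ℕ) a, ‖x a ⊓ n • z‖ ≤ M := fun n a =>
    (norm_le_norm_of_abs_le_abs (abs_le_abs_of_nonneg (hg0 n a) inf_le_left)).trans (hM a)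
  have hbounded : ∀ t K : ℝ, 0 ≤ t → (∀ n : ℕ, n * t ≤ K) → t = 0 := by
    intro t K ht h
    exact eq_zero_of_forall_nsmul_le (e := K) ht (by simpa using h)
  suffices z = 0 from le_sup_left.trans this.le
  rcases hX with hX | hX
  · by_contra hne
    obtain ⟨f, hf, hfz⟩ := hX z 0 hne
    obtain ⟨C, hC⟩ := exists_abs_le_mul_norm_of_orderBounded f hf.1
    refine hfz ?_
    rw [map_zero, ← abs_eq_zero]
    refine hbounded _ (|C| * M) (abs_nonneg _) fun n => ?_
    have := abs_apply_le_of_isLUB hf (hginc n) (hlub n) fun a =>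
      (hC _ (hg0 n a)).trans (mul_le_mul (le_abs_self C) (hgM n a) (norm_nonneg _) (abs_nonneg C))
    simpa [abs_mul] using this
  · obtain ⟨r, hr, h⟩ := hX.exists_norm_le (ι := ι)
    rw [← norm_eq_zero]
    refine hbounded _ (r * M) (norm_nonneg _) fun n => ?_
    have := h _ _ M (hginc n) (hlub n) (hgM n)
    rwa [← Nat.cast_smul_eq_nsmul ℝ, norm_smul, Real.norm_natCast] at this
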